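/- Let $K$ be a field of characteristic zero or $K=\mathbb Z$, and let $n,m\ge 0$ be integers. A seed $(\mathbf x,\mathbf y,B)$ in a field $\mathcal F\supseteq K$ consists of elements $x_1,\dots,x_{n+m}\in\mathcal F$, algebraically independent over $K$ and generating $\mathcal F$ as a field over (the quotient field of) $K$, where $\mathbf x=(x_1,\dots,x_n)$ are the exchangeable and $\mathbf y=(x_{n+1},\dots,x_{n+m})$ the frozen variables, together with an integer $(n+m)\times n$ matrix $B=(b_{jk})$ whose principal part is skew-symmetrizable, i.e. $d_jb_{jk}=-d_kb_{kj}$ for all $j,k\in[1,n]$, for some positive integers $d_1,\dots,d_n$. For $i\in[1,n]$ the mutation of the seed in direction $i$ is $(\mathbf x_i,\mathbf y,B_i)$, where $\mathbf x_i$ is obtained from $\mathbf x$ by replacing $x_i$ with $$x_i'=\frac1{x_i}\Bigl(\prod_{b_{ki}>0}x_k^{b_{ki}}+\prod_{b_{ki}<0}x_k^{-b_{ki}}\Bigr),$$ and $B_i$ has entries $-b_{jk}$ if $j=i$ or $k=i$, and $b_{jk}+\frac12(|b_{ji}|b_{ik}+b_{ji}|b_{ik}|)$ otherwise. Two seeds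 are mutation-equivalent if one arises from the other by finitely many mutations. For a seed with exchangeable variables $\mathbf z$ (and frozen variables $\mathbf y$) write $\mathcal L_{\mathbf z}=K[u^{\pm1}\mid u\in\mathbf z\cup\mathbf y]\subseteq\mathcal F$. The upper cluster algebra of a seed is $\mathcal U=\bigcap\mathcal L_{\mathbf z}$, where the intersection runs over all seeds $(\mathbf z,\mathbf y,C)$ mutation-equivalent to it. Let $\mathcal U$ be the upper cluster algebra of a seed, and let $(\mathbf x,\mathbf y,B)$ be a seed mutation-equivalent to that seed at which $\mathcal U$ satisfies the starfish condition $$\mathcal U=\mathcal L_{\mathbf x}\cap\bigcap_{i=1}^n\mathcal L_{\mathbf x_i}.$$ Let $i\in[1,n]$ and let $\mathfrak p$ be a height-1 prime ideal of $\mathcal U$ that contains $x_i$. Then $\mathfrak p\mathcal L_{\mathbf x_i}$ is a height-1 prime ideal of $\mathcal L_{\mathbf x_i}$. In particular, $\mathfrak p$ contains no element of $\{x_1,\dots,x_{i-1},x_i',x_{i+1},\dots,x_{n+m}\}$. -/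

import Mathlib

/-- The data of a (labelled) seed with `n` exchangeable and `m` frozen variables inside a field `F`:
the extended cluster `(x₁, …, xₙ, xₙ₊₁, …, xₙ₊ₘ)` and an `(n + m) × n` integer matrix.
The index `Sum.inl i` is exchangeable, the index `Sum.inr j` is frozen.
The conditions that make such data a seed are in `SeedData.IsSeed`. -/
structure SeedData (F : Type*) (n m : ℕ) where
  /-- the exchangeable variables (at `Sum.inl i`) and the frozen variables (at `Sum.inr j`) -/
  var : Fin n ⊕ Fin m → F
  /-- the matrix `B` -/
  B : Matrix (Fin n ⊕ Fin m) (Fin n) ℤ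

/-- An `(n + m) × n` integer matrix is an exchange matrix if its principal part `(b_ij)`, `i, j ≤ n`,
is skew-symmetrizable: `D * (b_ij)` is skew-symmetric for some diagonal matrix `D` with positive
integer diagonal entries. -/
def IsExchangeMatrix {n m : ℕ} (B : Matrix (Fin n ⊕ Fin m) (Fin n) ℤ) : Prop :=
  ∃ d : Fin n → ℤ, (∀ i, 0 < d i) ∧
    ∀ i j, d i * B (Sum.inl i) j = -(d j * B (Sum.inl j) i)

namespace SeedData

variable {F : Type*} [Field F] {n m : ℕ}

/-- `(x, y, B)` is a seed over `K` with ambient field `F`: the variables are algebraically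
independent over `K`, the field `F` is generated by `K` and the variables
(that is, `F = q(K)(x₁, …, xₙ₊ₘ)`), and `B` is an exchange matrix. -/
structure IsSeed (K : Type*) [CommRing K] [Algebra K F] (S : SeedData F n m) : Prop where
  algebraicIndependent : AlgebraicIndependent K S.var
  closure_eq_top : Subfield.closure (Set.range (algebraMap K F) ∪ Set.range S.var) = ⊤
  isExchangeMatrix : IsExchangeMatrix S.B

/-- The exchange polynomial `f_i = ∏_{b_ki > 0} x_k ^ b_ki + ∏_{b_ki < 0} x_k ^ (-b_ki)`, as an
element of `F`; `k` runs over all exchangeable and frozen indices.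
(`Int.toNat` of a negative integer is `0`, so the other factors are `1`.) -/
def exchangePolynomial (S : SeedData F n m) (i : Fin n) : F :=
  ∏ k, S.var k ^ (S.B k i).toNat + ∏ k, S.var k ^ (-S.B k i).toNat

/-- The mutation of a seed in the exchangeable direction `i`. The variable `x_i` is replaced by
`x_i' = f_i / x_i`. The integer division by `2` is exact, since `|a| * b + a * |b|` is even. -/
def mutate (S : SeedData F n m) (i : Fin n) : SeedData F n m where
  var := Function.update S.var (Sum.inl i) (S.exchangePolynomial i / S.var (Sum.inl i))
  B := fun j k =>
    if j = Sum.inl i ∨ k = i then -S.B j k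
    else S.B j k + (|S.B j i| * S.B (Sum.inl i) k + S.B j i * |S.B (Sum.inl i) k|) / 2

/-- `T` is obtained from `S` by a finite (possibly empty) sequence of mutations. -/
def MutationEquiv (S T : SeedData F n m) : Prop :=
  Relation.ReflTransGen (fun S' T' => ∃ i : Fin n, T' = S'.mutate i) S T

lemma MutationEquiv.mutate {S T : SeedData F n m} (h : S.MutationEquiv T) (i : Fin n) :
    S.MutationEquiv (T.mutate i) :=
  Relation.ReflTransGen.tail h ⟨i, rfl⟩

variable (K : Type*) [CommRing K] [Algebra K F]

/-- The ring of Laurent polynomials `K[u^{±1} ∣ u ∈ x ∪ y]` of a seed, as a subalgebra of `F`. -/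
def laurentRing (S : SeedData F n m) : Subalgebra K F :=
  Algebra.adjoin K (Set.range S.var ∪ Set.range fun k => (S.var k)⁻¹)

/-- The upper cluster algebra of a seed: the intersection of the Laurent polynomial rings of all
mutation-equivalent seeds. -/
def upperClusterAlgebra (S : SeedData F n m) : Subalgebra K F :=
  ⨅ (T : SeedData F n m) (_ : S.MutationEquiv T), T.laurentRing K

lemma upperClusterAlgebra_le {S T : SeedData F n m} (h : S.MutationEquiv T) :
    S.upperClusterAlgebra K ≤ T.laurentRing K :=
  iInf₂_le T h

/-- The algebra `U` satisfies the starfish condition at the seed `S`: it is the intersection of the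
Laurent polynomial rings of `S` and of its mutations in the `n` exchangeable directions. -/
def Starfish (U : Subalgebra K F) (S : SeedData F n m) : Prop :=
  U = S.laurentRing K ⊓ ⨅ i : Fin n, (S.mutate i).laurentRing K

end SeedData

/-! The variables of the mutated seed lie in `U`, and inverting them in `U` gives the whole Laurent
ring of that seed (`isLocalization_laurentRing`). Extension to a localization preserves primality
and height of a prime disjoint from the denominators, so everything reduces to showing that `p`
contains no variable `v` of the mutated seed (`mutate_var_notMem`). If `v` did lie in `p`, height
one would give `c ∉ p` with `c * v ^ N = x_i * u` in `U`. Then `c / x_i = u / v ^ N` lies in the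
Laurent ring mutated at `i`, while in the other Laurent rings of the starfish condition `x_i` is
already a unit. Hence `c / x_i ∈ U` and `c = x_i * (c / x_i) ∈ p`, a contradiction. -/

/-- Every element of a prime of height one is, up to elements outside the prime, nilpotent modulo
any nonzero element of the ring. -/
lemma Ideal.exists_dvd_mul_pow_of_height_eq_one {R : Type*} [CommRing R] [IsDomain R]
    {p : Ideal R} [p.IsPrime] (hp : p.height = 1) {a v : R} (ha0 : a ≠ 0)
    (hv : v ∈ p) : ∃ c ∉ p, ∃ N : ℕ, a ∣ c * v ^ N := by
  by_contra! h
  have hdisj : Disjoint (Ideal.span {a} : Set R) (p.primeCompl ⊔ Submonoid.powers v : Submonoid R) := by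
    rw [Set.disjoint_left]
    intro z hz hz'
    obtain ⟨c, hc, w, ⟨N, rfl⟩, rfl⟩ := Submonoid.mem_sup.mp hz'
    exact h c hc N (Ideal.mem_span_singleton.mp hz)
  -- Such a `q` contains `a` but not `v`, and lies strictly inside `p`; height one forces `q = 0`,
  -- against `a ≠ 0`.
  obtain ⟨q, hq, haq, hd⟩ := Ideal.exists_le_prime_disjoint _ _ hdisj
  rw [Set.disjoint_left] at hd
  have hvq : v ∉ q := fun hvq =>
    hd hvq ((le_sup_right : _ ≤ p.primeCompl ⊔ _) (Submonoid.mem_powers v))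
  have hqp : q ≤ p := fun z hz => by
    by_contra hzp
    exact hd hz ((le_sup_left : p.primeCompl ≤ _) hzp)
  have hlt : q < p := lt_of_le_of_ne hqp fun e => hvq (e ▸ hv)
  have hq0 := (Ideal.height_le_iff (n := 1)).mp hp.le q hq hlt
  rw [Nat.cast_one, Order.lt_one_iff, Ideal.height_eq_zero_iff_eq_bot] at hq0
  subst hq0
  exact ha0 (by simpa using haq (Ideal.mem_span_singleton_self a))

/-- In an algebraically independent family in a field, a member `x i` may be replaced by `f / x i`
for any nonzero `f` in the algebra generated by the other members. -/
lemma AlgebraicIndependent.update_div {ι K F : Type*} [DecidableEq ι] [CommRing K] [Field F]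
    [Algebra K F] {x : ι → F} (hx : AlgebraicIndependent K x) (i : ι) {f : F} (hf0 : f ≠ 0)
    (hf : f ∈ Algebra.adjoin K (x '' {i}ᶜ)) :
    AlgebraicIndependent K (Function.update x i (f / x i)) := by
  have himage : Function.update x i (f / x i) '' {i}ᶜ = x '' {i}ᶜ :=
    Set.image_congr fun j hj => Function.update_of_ne hj _ _
  have hsub : (fun j : {j // j ≠ i} => Function.update x i (f / x i) j) =
      fun j : {j // j ≠ i} => x j :=
    funext fun j => Function.update_of_ne j.2 _ _
  obtain ⟨h1, h2⟩ := (AlgebraicIndependent.iff_transcendental_adjoin_image i).mp hx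
  rw [AlgebraicIndependent.iff_transcendental_adjoin_image i, hsub, himage,
    Function.update_self]
  -- If `f / x i` were algebraic over the other members, so would be `x i = f * (f / x i)⁻¹`.
  refine ⟨h1, fun halg => h2 ?_⟩
  have hfalg : IsAlgebraic (Algebra.adjoin K (x '' {i}ᶜ)) f :=
    haveI := (algebraMap K F).domain_nontrivial
    isAlgebraic_algebraMap (⟨f, hf⟩ : Algebra.adjoin K (x '' {i}ᶜ))
  have := hfalg.mul halg.inv
  rwa [inv_div, mul_div_cancel₀ _ hf0] at this

/-! ### Exchange matrices and seeds under mutation -/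

namespace IsExchangeMatrix

variable {n m : ℕ} {B : Matrix (Fin n ⊕ Fin m) (Fin n) ℤ}

lemma apply_self (h : IsExchangeMatrix B) (i : Fin n) : B (Sum.inl i) i = 0 := by
  obtain ⟨d, hd, h⟩ := h
  have := h i i
  have : d i * B (Sum.inl i) i = 0 := by lia
  exact (mul_eq_zero.mp this).resolve_left (hd i).ne'

lemma two_mul_mutate_div (a b : ℤ) : 2 * ((|a| * b + a * |b|) / 2) = |a| * b + a * |b| := by
  apply Int.mul_ediv_cancel'
  rcases abs_cases a with ⟨ha, _⟩ | ⟨ha, _⟩ <;> rcases abs_cases b with ⟨hb, _⟩ | ⟨hb, _⟩ <;>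
    rw [ha, hb]
  exacts [⟨a * b, by ring⟩, ⟨0, by ring⟩, ⟨0, by ring⟩, ⟨-(a * b), by ring⟩]

end IsExchangeMatrix

namespace SeedData

section

variable {F : Type*} [Field F] {n m : ℕ} {S : SeedData F n m}

/-- The same `d` works: taking absolute values in the skew-symmetry relation gives `d a * |b_ab| = d
b * |b_ba|`, which handles the correction term once doubling has cleared the division. -/
lemma isExchangeMatrix_mutate (h : IsExchangeMatrix S.B) (i : Fin n) :
    IsExchangeMatrix (S.mutate i).B := by
  obtain ⟨d, hd, h⟩ := h
  refine ⟨d, hd, fun j k => ?_⟩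
  simp only [mutate, Sum.inl.injEq]
  have hjk := h j k
  by_cases hji : j = i
  · simp [hji] at hjk ⊢; lia
  by_cases hki : k = i
  · simp [hki] at hjk ⊢; lia
  simp only [hji, hki, or_self, if_false]
  have habs (a b : Fin n) : d a * |S.B (Sum.inl a) b| = d b * |S.B (Sum.inl b) a| := by
    have := congrArg abs (h a b)
    rwa [abs_neg, abs_mul, abs_mul, abs_of_pos (hd a), abs_of_pos (hd b)] at this
  have e1 := IsExchangeMatrix.two_mul_mutate_div (S.B (Sum.inl j) i) (S.B (Sum.inl i) k)
  have e2 := IsExchangeMatrix.two_mul_mutate_div (S.B (Sum.inl k) i) (S.B (Sum.inl i) j)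
  refine mul_left_cancel₀ (two_ne_zero (α := ℤ)) ?_
  linear_combination 2 * hjk + d j * e1 + d k * e2 + S.B (Sum.inl i) k * habs j i +
    |S.B (Sum.inl i) k| * h j i + |S.B (Sum.inl i) j| * h i k +
    S.B (Sum.inl i) j * habs k i

lemma mutate_var_self (S : SeedData F n m) (i : Fin n) :
    (S.mutate i).var (Sum.inl i) = S.exchangePolynomial i / S.var (Sum.inl i) :=
  Function.update_self _ _ _

lemma mutate_var_of_ne (S : SeedData F n m) {i : Fin n} {k : Fin n ⊕ Fin m}
    (hk : k ≠ Sum.inl i) : (S.mutate i).var k = S.var k :=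
  Function.update_of_ne hk _ _

lemma exchangePolynomial_mem {K : Type*} [CommRing K] [Algebra K F] {A : Subalgebra K F}
    {i : Fin n} (hB : S.B (Sum.inl i) i = 0) (hA : ∀ k ≠ Sum.inl i, S.var k ∈ A) :
    S.exchangePolynomial i ∈ A := by
  refine add_mem (prod_mem fun k _ => ?_) (prod_mem fun k _ => ?_) <;>
  · by_cases hk : k = Sum.inl i
    · simp [hk, hB]
    · exact pow_mem (hA k hk) _

/-- Setting all variables to `1` gives `2`, which is nonzero in characteristic zero. -/
lemma exchangePolynomial_ne_zero {K : Type*} [CommRing K] [CharZero K] [Algebra K F]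
    (h : AlgebraicIndependent K S.var) (i : Fin n) : S.exchangePolynomial i ≠ 0 := by
  intro h0
  let P : MvPolynomial (Fin n ⊕ Fin m) K :=
    ∏ k, MvPolynomial.X k ^ (S.B k i).toNat + ∏ k, MvPolynomial.X k ^ (-S.B k i).toNat
  have hP : MvPolynomial.aeval S.var P = 0 := by
    simpa [P, exchangePolynomial] using h0
  have hP0 : P = 0 := (injective_iff_map_eq_zero _).mp h P hP
  have := congrArg (MvPolynomial.eval fun _ => (1 : K)) hP0
  simp [P, one_add_one_eq_two] at this

/-- The properties of a seed which make the exchange relations nondegenerate. -/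
structure IsNondegenerate (S : SeedData F n m) : Prop where
  var_ne_zero : ∀ k, S.var k ≠ 0
  exchangePolynomial_ne_zero : ∀ i, S.exchangePolynomial i ≠ 0
  apply_self : ∀ i, S.B (Sum.inl i) i = 0

section AlgebraicIndependent

variable {K : Type*} [CommRing K] [CharZero K] [Algebra K F]

lemma algebraicIndependent_mutate (h : AlgebraicIndependent K S.var) (hB : IsExchangeMatrix S.B)
    (i : Fin n) : AlgebraicIndependent K (S.mutate i).var :=
  h.update_div _ (exchangePolynomial_ne_zero h i) <|
    exchangePolynomial_mem (hB.apply_self i) fun _ hk =>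
      Algebra.subset_adjoin (Set.mem_image_of_mem _ hk)

lemma MutationEquiv.isNondegenerate {S₀ : SeedData F n m} (hS : S₀.MutationEquiv S)
    (hS₀ : S₀.IsSeed K) : S.IsNondegenerate := by
  have key : AlgebraicIndependent K S.var ∧ IsExchangeMatrix S.B := by
    induction hS with
    | refl => exact ⟨hS₀.algebraicIndependent, hS₀.isExchangeMatrix⟩
    | tail _ hT ih =>
      obtain ⟨i, rfl⟩ := hT
      exact ⟨algebraicIndependent_mutate ih.1 ih.2 i, isExchangeMatrix_mutate ih.2 i⟩
  exact ⟨key.1.ne_zero, fun i => SeedData.exchangePolynomial_ne_zero key.1 i,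
    key.2.apply_self⟩

end AlgebraicIndependent

/-! ### Cluster variables in neighbouring Laurent rings -/

section LaurentRing

variable (K : Type*) [CommRing K] [Algebra K F]

lemma var_mem_laurentRing (S : SeedData F n m) (k : Fin n ⊕ Fin m) :
    S.var k ∈ S.laurentRing K :=
  Algebra.subset_adjoin (Or.inl ⟨k, rfl⟩)

lemma inv_var_mem_laurentRing (S : SeedData F n m) (k : Fin n ⊕ Fin m) :
    (S.var k)⁻¹ ∈ S.laurentRing K :=
  Algebra.subset_adjoin (Or.inr ⟨k, rfl⟩)

lemma var_mem_laurentRing_mutate_of_ne (S : SeedData F n m) {i : Fin n}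
    {k : Fin n ⊕ Fin m} (hk : k ≠ Sum.inl i) : S.var k ∈ (S.mutate i).laurentRing K :=
  S.mutate_var_of_ne hk ▸ (S.mutate i).var_mem_laurentRing K k

lemma inv_var_mem_laurentRing_mutate_of_ne (S : SeedData F n m) {i : Fin n}
    {k : Fin n ⊕ Fin m} (hk : k ≠ Sum.inl i) : (S.var k)⁻¹ ∈ (S.mutate i).laurentRing K :=
  S.mutate_var_of_ne hk ▸ (S.mutate i).inv_var_mem_laurentRing K k

end LaurentRing

namespace IsNondegenerate

variable (K : Type*) [CommRing K] [Algebra K F] (hS : S.IsNondegenerate)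

include hS

lemma mutate_var_ne_zero (i : Fin n) (k : Fin n ⊕ Fin m) : (S.mutate i).var k ≠ 0 := by
  by_cases hk : k = Sum.inl i
  · subst hk
    rw [mutate_var_self]
    exact div_ne_zero (hS.exchangePolynomial_ne_zero i) (hS.var_ne_zero _)
  · rw [S.mutate_var_of_ne hk]
    exact hS.var_ne_zero k

lemma var_mem_laurentRing_mutate (j : Fin n) (k : Fin n ⊕ Fin m) :
    S.var k ∈ (S.mutate j).laurentRing K := by
  by_cases hk : k = Sum.inl j
  · subst hk
    have h1 : S.exchangePolynomial j ∈ (S.mutate j).laurentRing K :=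
      exchangePolynomial_mem (hS.apply_self j) fun k hk =>
        S.var_mem_laurentRing_mutate_of_ne K hk
    have h2 := mul_mem h1 ((S.mutate j).inv_var_mem_laurentRing K (Sum.inl j))
    rwa [mutate_var_self, inv_div, mul_div_cancel₀ _ (hS.exchangePolynomial_ne_zero j)] at h2
  · exact S.var_mem_laurentRing_mutate_of_ne K hk

lemma mutate_var_mem_laurentRing (i : Fin n) (k : Fin n ⊕ Fin m) :
    (S.mutate i).var k ∈ S.laurentRing K := by
  by_cases hk : k = Sum.inl i
  · subst hk
    rw [mutate_var_self, div_eq_mul_inv]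
    exact mul_mem (exchangePolynomial_mem (hS.apply_self i) fun _ _ => S.var_mem_laurentRing K _)
      (S.inv_var_mem_laurentRing K _)
  · rw [S.mutate_var_of_ne hk]
    exact S.var_mem_laurentRing K k

/-- For `i ≠ j`, the variable `x_i` survives mutation at `j` and is a unit there, so `f_i / x_i`
makes sense in that ring. -/
lemma mutate_var_mem_laurentRing_mutate (i j : Fin n) (k : Fin n ⊕ Fin m) :
    (S.mutate i).var k ∈ (S.mutate j).laurentRing K := by
  by_cases hij : i = j
  · exact hij ▸ (S.mutate i).var_mem_laurentRing K k
  by_cases hk : k = Sum.inl i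
  · subst hk
    rw [mutate_var_self, div_eq_mul_inv]
    exact mul_mem (exchangePolynomial_mem (hS.apply_self i) fun k _ =>
      hS.var_mem_laurentRing_mutate K j k)
      (S.inv_var_mem_laurentRing_mutate_of_ne K (by simpa using hij))
  · rw [S.mutate_var_of_ne hk]
    exact hS.var_mem_laurentRing_mutate K j k

end IsNondegenerate

/-! ### Consequences of the starfish condition -/

namespace Starfish

variable {K : Type*} [CommRing K] [Algebra K F] {U : Subalgebra K F} (hstar : Starfish K U S)

include hstar

lemma mem_iff {z : F} :
    z ∈ U ↔ z ∈ S.laurentRing K ∧ ∀ i, z ∈ (S.mutate i).laurentRing K := by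
  have h : U = S.laurentRing K ⊓ ⨅ i : Fin n, (S.mutate i).laurentRing K := hstar
  rw [h, Algebra.mem_inf, Algebra.mem_iInf]

lemma le_laurentRing_mutate (i : Fin n) : U ≤ (S.mutate i).laurentRing K :=
  fun _ hz => (hstar.mem_iff.mp hz).2 i

lemma mutate_var_mem (hS : S.IsNondegenerate) (i : Fin n) (k : Fin n ⊕ Fin m) :
    (S.mutate i).var k ∈ U :=
  hstar.mem_iff.mpr ⟨hS.mutate_var_mem_laurentRing K i k,
    fun j => hS.mutate_var_mem_laurentRing_mutate K i j k⟩

/-- A prime of height one containing `x i` contains no variable of the seed mutated at `i`. -/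
lemma mutate_var_notMem (hS : S.IsNondegenerate) {p : Ideal U} [p.IsPrime] (hp : p.height = 1)
    {i : Fin n} {x v : U} (hx : (x : F) = S.var (Sum.inl i)) (hxp : x ∈ p)
    {k : Fin n ⊕ Fin m} (hv : (v : F) = (S.mutate i).var k) : v ∉ p := by
  intro hvp
  have hx0 : (x : F) ≠ 0 := hx ▸ hS.var_ne_zero _
  have hv0 : (v : F) ≠ 0 := hv ▸ hS.mutate_var_ne_zero i k
  obtain ⟨c, hc, N, u, hu⟩ :=
    Ideal.exists_dvd_mul_pow_of_height_eq_one hp (a := x) (fun h => hx0 (by simp [h])) hvp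
  have hu' : (c : F) * (v : F) ^ N = x * u := by exact_mod_cast congrArg Subtype.val hu
  have hinv : ∀ {A : Subalgebra K F}, (S.var (Sum.inl i))⁻¹ ∈ A → U ≤ A → (c : F) * (x : F)⁻¹ ∈ A :=
    fun h1 h2 => mul_mem (h2 c.2) (hx ▸ h1)
  have hmem : (c : F) * (x : F)⁻¹ ∈ U := by
    refine hstar.mem_iff.mpr ⟨hinv (S.inv_var_mem_laurentRing K _)
      fun z hz => (hstar.mem_iff.mp hz).1, fun j => ?_⟩
    -- Only in direction `i` may `x_i` fail to be a unit; there `c / x_i` is rewritten with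
    -- denominator `v ^ N`.
    by_cases hij : i = j
    · subst hij
      have : (c : F) * (x : F)⁻¹ = u * ((v : F)⁻¹) ^ N := by
        rw [inv_pow, ← div_eq_mul_inv, ← div_eq_mul_inv, div_eq_div_iff hx0 (pow_ne_zero N hv0),
          hu', mul_comm]
      rw [this, hv]
      exact mul_mem (hstar.le_laurentRing_mutate i u.2)
        (pow_mem ((S.mutate i).inv_var_mem_laurentRing K k) N)
    · exact hinv (S.inv_var_mem_laurentRing_mutate_of_ne K (by simpa using hij))
        (hstar.le_laurentRing_mutate j)
  refine hc ?_
  have : c = x * ⟨_, hmem⟩ := Subtype.ext (by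
    rw [MulMemClass.coe_mul, mul_left_comm, mul_inv_cancel₀ hx0, mul_one])
  rw [this]
  exact p.mul_mem_right _ hxp

end Starfish

/-- A subalgebra between the polynomial ring and the Laurent polynomial ring of a cluster has that
Laurent polynomial ring as its localization at the variables. -/
lemma isLocalization_laurentRing {K : Type*} [CommRing K] [Algebra K F] {U : Subalgebra K F}
    (T : SeedData F n m) (hle : U ≤ T.laurentRing K) (hmem : ∀ k, T.var k ∈ U)
    (h0 : ∀ k, T.var k ≠ 0) :
    letI := (Subalgebra.inclusion hle).toRingHom.toAlgebra
    IsLocalization (Submonoid.closure (Set.range fun k => (⟨T.var k, hmem k⟩ : U)))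
      (T.laurentRing K) := by
  let := (Subalgebra.inclusion hle).toRingHom.toAlgebra
  rw [isLocalization_iff]
  refine ⟨?_, ?_, fun {x y} h => ⟨1, by simpa using Subalgebra.inclusion_injective hle h⟩⟩
  · rintro ⟨y, hy⟩
    induction hy using Submonoid.closure_induction with
    | mem y hy =>
      obtain ⟨k, rfl⟩ := hy
      exact IsUnit.of_mul_eq_one ⟨_, T.inv_var_mem_laurentRing K k⟩
        (Subtype.ext (mul_inv_cancel₀ (h0 k)))
    | one => simp
    | mul y z _ _ hy hz => simpa using hy.mul hz
  · rintro ⟨z, hz⟩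
    suffices h : ∃ y ∈ Submonoid.closure (Set.range fun k => (⟨T.var k, hmem k⟩ : U)),
        z * y ∈ U by
      obtain ⟨y, hy, hzy⟩ := h
      exact ⟨(⟨_, hzy⟩, ⟨y, hy⟩), rfl⟩
    change z ∈ Algebra.adjoin K _ at hz
    induction hz using Algebra.adjoin_induction with
    | mem z hz =>
      rcases hz with ⟨k, rfl⟩ | ⟨k, rfl⟩
      · exact ⟨1, one_mem _, by simpa using hmem k⟩
      · refine ⟨_, Submonoid.subset_closure ⟨k, rfl⟩, ?_⟩
        by_cases hk : T.var k = 0 <;> simp [hk]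
    | algebraMap r => exact ⟨1, one_mem _, by simp⟩
    | add a b _ _ ha hb =>
      obtain ⟨y, hy, hay⟩ := ha
      obtain ⟨w, hw, hbw⟩ := hb
      refine ⟨y * w, mul_mem hy hw, ?_⟩
      have : (a + b) * ((y * w : U) : F) = a * y * w + b * w * y := by push_cast; ring
      rw [this]
      exact add_mem (mul_mem hay w.2) (mul_mem hbw y.2)
    | mul a b _ _ ha hb =>
      obtain ⟨y, hy, hay⟩ := ha
      obtain ⟨w, hw, hbw⟩ := hb
      refine ⟨y * w, mul_mem hy hw, ?_⟩
      have : a * b * ((y * w : U) : F) = a * y * (b * w) := by push_cast; ring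
      rw [this]
      exact mul_mem hay hbw

end

end SeedData

theorem corollary3p6 {K F : Type*} [CommRing K] [Field F] [Algebra K F]
    (hK : (IsField K ∧ CharZero K) ∨ Nonempty (K ≃+* ℤ))
    {n m : ℕ} (S₀ : SeedData F n m) (hS₀ : S₀.IsSeed K)
    (S : SeedData F n m) (hS : S₀.MutationEquiv S)
    (hstar : SeedData.Starfish K (S₀.upperClusterAlgebra K) S)
    (p : Ideal (S₀.upperClusterAlgebra K)) (hp : p.IsPrime) (hheight : p.height = 1)
    (i : Fin n)
    (hi : S.var (Sum.inl i) ∈ ((↑) : S₀.upperClusterAlgebra K → F) '' (p : Set _)) :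
    ((p.map (Subalgebra.inclusion
        (SeedData.upperClusterAlgebra_le K (hS.mutate i)))).IsPrime ∧
      (p.map (Subalgebra.inclusion
        (SeedData.upperClusterAlgebra_le K (hS.mutate i)))).height = 1) ∧
    ∀ k : Fin n ⊕ Fin m,
      (S.mutate i).var k ∉ ((↑) : S₀.upperClusterAlgebra K → F) '' (p : Set _) := by
  have : CharZero K := by
    rcases hK with ⟨_, h⟩ | ⟨⟨e⟩⟩
    · exact h
    · exact charZero_of_injective_ringHom (f := e.symm.toRingHom) e.symm.injective
  have hnd := hS.isNondegenerate hS₀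
  obtain ⟨x, hxp, hx⟩ := hi
  have hnot (k : Fin n ⊕ Fin m) :
      (S.mutate i).var k ∉ ((↑) : S₀.upperClusterAlgebra K → F) '' (p : Set _) := by
    rintro ⟨v, hvp, hv⟩
    exact hstar.mutate_var_notMem hnd hheight hx hxp hv hvp
  refine ⟨?_, hnot⟩
  have hmem := hstar.mutate_var_mem hnd i
  have hle := SeedData.upperClusterAlgebra_le K (hS.mutate i)
  let := (Subalgebra.inclusion hle).toRingHom.toAlgebra
  have hloc := SeedData.isLocalization_laurentRing (S.mutate i) hle hmem
    (hnd.mutate_var_ne_zero i)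
  have hdisj : Disjoint
      (Submonoid.closure (Set.range fun k => (⟨(S.mutate i).var k, hmem k⟩ :
        S₀.upperClusterAlgebra K)) : Set (S₀.upperClusterAlgebra K)) p := by
    -- As `p` is prime, its complement is a submonoid, so avoiding the generators suffices.
    have : Submonoid.closure (Set.range fun k => (⟨(S.mutate i).var k, hmem k⟩ :
        S₀.upperClusterAlgebra K)) ≤ p.primeCompl := by
      rw [Submonoid.closure_le]
      rintro _ ⟨k, rfl⟩ hk
      exact hnot k ⟨_, hk, rfl⟩
    exact Set.disjoint_left.mpr fun z hz => this hz
  exact ⟨IsLocalization.isPrime_of_isPrime_disjoint _ _ p hp hdisj,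
    (IsLocalization.height_map_of_disjoint _ p hdisj).trans hheight⟩
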